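/- **Theorem 1.2 (ODE Neumann Comparison Principle).** Let $f\in L^1[0,\pi]$ be real-valued with $\int_0^\pi f\,dx=0$, and let $f^{\ast}:[0,\pi]\to[-\infty,+\infty]$ be its decreasing rearrangement, that is, $$f^{\ast}(0)=\operatorname*{ess\,sup}_{[0,\pi]} f,\qquad f^{\ast}(t)=\inf\{s\in\mathbb{R}:|\{x\in[0,\pi]:f(x)>s\}|\le t\}\ \ (0<t<\pi),\qquad f^{\ast}(\pi)=\operatorname*{ess\,inf}_{[0,\pi]} f,$$ where $|E|$ denotes the length (Lebesgue measure) of $E$. Suppose $u$ and $v$ solve the Poisson problems $$-u''=f \ \text{ in } (0,\pi),\quad u'(0)=u'(\pi)=0,\qquad\qquad -v''=f^{\ast}\ \text{ in } (0,\pi),\quad v'(0)=v'(\pi)=0,$$ in the sense that $u,v\in C^1[0,\pi]$, the derivatives $u',v'$ are absolutely continuous on $[0,\pi]$, and the differential equations hold almost everywhere on $(0,\pi)$. If $u$ and $v$ both have zero mean, $\int_0^\pi u\,dx=\int_0^\pi v\,dx=0$, then $$\int_0^\pi\phi(u)\,dx\le\int_0^\pi\phi(v)\,dx$$ for each convex function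 $\phi:\mathbb{R}\to\mathbb{R}$ (both integrands being integrable). In particular, $$\|u\|_{L^p[0,\pi]}\le\|v\|_{L^p[0,\pi]},\qquad 1\le p\le+\infty,$$ $$\max_{[0,\pi]}u\le\max_{[0,\pi]}v,\qquad \min_{[0,\pi]}v\le\min_{[0,\pi]}u,\qquad \operatorname*{osc}_{[0,\pi]}u\le\operatorname*{osc}_{[0,\pi]}v,$$ where $\operatorname{osc}=\max-\min$. -/

import Mathlib

open MeasureTheory Set

/-- The decreasing rearrangement `f^* : [0, |X|] → [-∞, +∞]` of a function `f` on `X ⊆ ℝ`: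
`ess sup f` at `t = 0`, `inf {s : |{x ∈ X : s < f x}| ≤ t}` for `0 < t < |X|`, and
`ess inf f` at `t = |X|`. (Only the arguments `t ∈ [0, |X|]` are meaningful.) -/
noncomputable def decreasingRearrangement (X : Set ℝ) (f : ℝ → ℝ) (t : ℝ) : EReal :=
  if t = 0 then essSup (fun x => (f x : EReal)) (volume.restrict X)
  else if ENNReal.ofReal t < volume X then
    sInf ((fun s : ℝ => (s : EReal)) '' {s : ℝ | volume {x ∈ X | s < f x} ≤ ENNReal.ofReal t})
  else essInf (fun x => (f x : EReal)) (volume.restrict X)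

/-- `u` solves the Neumann problem `-u'' = g` in `(a, b)`, `u'(a) = u'(b) = 0`:
`u` is `C¹` on `[a, b]`, `u'` is absolutely continuous on `[a, b]`, and `-u'' = g` almost
everywhere on `(a, b)`. The derivative on `[a, b]` is one-sided at the end points. The right-hand
side `g` may take infinite values, but the equation forces it to be finite almost everywhere. -/
structure IsNeumannSolution (a b : ℝ) (g : ℝ → EReal) (u : ℝ → ℝ) : Prop where
  contDiffOn : ContDiffOn ℝ 1 u (Icc a b)
  absolutelyContinuous : AbsolutelyContinuousOnInterval (derivWithin u (Icc a b)) a b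
  equation : ∀ᵐ x ∂(volume.restrict (Ioo a b)),
    ∃ w : ℝ, HasDerivAt (derivWithin u (Icc a b)) w x ∧ ((-w : ℝ) : EReal) = g x
  left_boundary : derivWithin u (Icc a b) a = 0
  right_boundary : derivWithin u (Icc a b) b = 0

open Filter
open scoped Topology

/-! Write `U` for the decreasing rearrangement of `u`. The heart of the proof is that `v - U` is
decreasing on the open interval. Given `a < b` with `U b < U a`, let `H` be `u` cut off at the
levels `U b` and `U a`. Testing the weak equation with `H - U b` bounds the energy `∫ H'²` by `∫ f
(H - U b)`. The region between the levels has length at most `b - a`, and `H` takes both extreme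
values, so a Cauchy–Schwarz argument gives `(U a - U b)² ≤ (b - a) ∫ f (H - U b)`
(`IsNeumannSolution.sq_sub_le`). Divided by `U a - U b`, the function `H - U b` becomes a density
with values in `[0, 1]` and mass `m ∈ [a, b]`. The bathtub principle
(`integral_mul_le_integral_realRearrangement`) then yields `U a - U b ≤ -v' m * (b - a)`, since `-v'
m` is the integral of the rearranged `f` over `(0, m)`. As `b` tends to `a`, this says that `U`
falls no faster than `v`.

Since `v - U` also has mean zero, `v` majorizes `U`. For `ψ` the right derivative of a convex `φ`,
one has `φ v - φ U ≥ ψ(U) (v - U)`, and Chebyshev's inequality makes the integral of the right side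
nonnegative. Equimeasurability replaces `U` by `u`; norms and extrema follow from special choices of
`φ`. -/

/-- The distribution function `s ↦ |{x ∈ [0, L] : s < f x}|`. -/
noncomputable def distribution (L : ℝ) (f : ℝ → ℝ) (s : ℝ) : ENNReal :=
  volume.restrict (Icc 0 L) {x | s < f x}

/-- The real-valued version of the decreasing rearrangement of `f` on `(0, L)`. -/
noncomputable def realRearrangement (L : ℝ) (f : ℝ → ℝ) (t : ℝ) : ℝ :=
  sInf {s : ℝ | distribution L f s ≤ ENNReal.ofReal t}

/-! ### Decreasing rearrangement, equimeasurability and the bathtub principle. -/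

section Rearrangement

variable {L : ℝ} {f : ℝ → ℝ}

lemma distribution_antitone : Antitone (distribution L f) :=
  fun _ _ h => measure_mono fun _ hx => lt_of_le_of_lt h hx

lemma tendsto_distribution_atTop (hf : AEMeasurable f (volume.restrict (Icc 0 L))) :
    Tendsto (fun n : ℕ => distribution L f n) atTop (𝓝 0) := by
  have h := tendsto_measure_iInter_atTop (μ := volume.restrict (Icc 0 L))
    (s := fun n : ℕ => {x | (n : ℝ) < f x})
    (fun n => nullMeasurableSet_lt aemeasurable_const hf)
    (fun m n hmn x hx => lt_of_le_of_lt (Nat.cast_le.2 hmn : (m : ℝ) ≤ n) hx)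
    ⟨0, measure_ne_top _ _⟩
  have he : (⋂ n : ℕ, {x | (n : ℝ) < f x}) = ∅ := by
    ext x
    obtain ⟨n, hn⟩ := exists_nat_gt (f x)
    simp only [mem_iInter, mem_ofPred_eq, mem_empty_iff_false, iff_false, not_forall, not_lt]
    exact ⟨n, hn.le⟩
  rw [he, measure_empty] at h
  exact h

lemma tendsto_distribution_neg_nat :
    Tendsto (fun n : ℕ => distribution L f (-n)) atTop (𝓝 (ENNReal.ofReal L)) := by
  have h := tendsto_measure_iUnion_atTop (μ := volume.restrict (Icc 0 L))
    (s := fun n : ℕ => {x | -(n : ℝ) < f x})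
    (fun m n hmn x hx => lt_of_le_of_lt (neg_le_neg (Nat.cast_le.2 hmn : (m : ℝ) ≤ n)) hx)
  have he : (⋃ n : ℕ, {x | -(n : ℝ) < f x}) = univ := by
    ext x
    obtain ⟨n, hn⟩ := exists_nat_gt (-f x)
    simp only [mem_iUnion, mem_ofPred_eq, mem_univ, iff_true]
    exact ⟨n, by linarith⟩
  rw [he, Measure.restrict_apply_univ, Real.volume_Icc, sub_zero] at h
  exact h

/-- The infimum is attained because the distribution function is right-continuous (continuity of
measure from below). The set is nonempty because `t > 0` and bounded below because `t < L`. -/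
lemma isLeast_realRearrangement (hf : AEMeasurable f (volume.restrict (Icc 0 L))) {t : ℝ}
    (ht : t ∈ Ioo 0 L) :
    IsLeast {s : ℝ | distribution L f s ≤ ENNReal.ofReal t} (realRearrangement L f t) := by
  have hne : {s : ℝ | distribution L f s ≤ ENNReal.ofReal t}.Nonempty := by
    obtain ⟨n, hn⟩ := ((tendsto_distribution_atTop hf).eventually
      (gt_mem_nhds (ENNReal.ofReal_pos.2 ht.1))).exists
    exact ⟨n, hn.le⟩
  have hbdd : BddBelow {s : ℝ | distribution L f s ≤ ENNReal.ofReal t} := by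
    obtain ⟨n, hn⟩ := ((tendsto_distribution_neg_nat (f := f)).eventually
      (lt_mem_nhds ((ENNReal.ofReal_lt_ofReal_iff (ht.1.trans ht.2)).2 ht.2))).exists
    refine ⟨-n, fun s hs => ?_⟩
    by_contra! hlt
    exact absurd ((distribution_antitone hlt.le).trans hs) (not_le.2 hn)
  refine ⟨?_, fun s hs => csInf_le hbdd hs⟩
  obtain ⟨a, ha, halt, hlim⟩ := exists_seq_strictAnti_tendsto (realRearrangement L f t)
  have h := tendsto_measure_iUnion_atTop (μ := volume.restrict (Icc 0 L))
    (s := fun n : ℕ => {x | a n < f x})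
    (fun m n hmn x hx => lt_of_le_of_lt (ha.antitone hmn) hx)
  have he : (⋃ n : ℕ, {x | a n < f x}) = {x | realRearrangement L f t < f x} := by
    ext x
    simp only [mem_iUnion, mem_ofPred_eq]
    refine ⟨fun ⟨n, hn⟩ => (halt n).trans hn, fun hx => ?_⟩
    exact (hlim.eventually (gt_mem_nhds hx)).exists
  rw [he] at h
  refine le_of_tendsto' h fun n => ?_
  obtain ⟨s, hs, hsa⟩ := exists_lt_of_csInf_lt hne (halt n)
  exact (distribution_antitone hsa.le).trans hs

lemma lt_realRearrangement_iff (hf : AEMeasurable f (volume.restrict (Icc 0 L))) {t : ℝ}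
    (ht : t ∈ Ioo 0 L) {s : ℝ} :
    s < realRearrangement L f t ↔ ENNReal.ofReal t < distribution L f s := by
  have h := isLeast_realRearrangement hf ht
  rw [← not_le, ← not_le, not_iff_not]
  exact ⟨fun hs => (distribution_antitone hs).trans h.1, fun hs => h.2 hs⟩

/-- Because the real infimum is attained, the extended one agrees with it. Infinite values can occur
only at the end points, which are null. -/
lemma decreasingRearrangement_eq_coe (hf : AEMeasurable f (volume.restrict (Icc 0 L))) {t : ℝ}
    (ht : t ∈ Ioo 0 L) :
    decreasingRearrangement (Icc 0 L) f t = (realRearrangement L f t : EReal) := by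
  have hlt : ENNReal.ofReal t < volume (Icc 0 L) := by
    rw [Real.volume_Icc, sub_zero]
    exact (ENNReal.ofReal_lt_ofReal_iff (ht.1.trans ht.2)).2 ht.2
  rw [decreasingRearrangement, if_neg ht.1.ne', if_pos hlt]
  have hs : {s : ℝ | volume {x ∈ Icc 0 L | s < f x} ≤ ENNReal.ofReal t} =
      {s : ℝ | distribution L f s ≤ ENNReal.ofReal t} := by
    ext s
    simp only [mem_ofPred_eq, distribution, Measure.restrict_apply' measurableSet_Icc]
    rw [show {x | x ∈ Icc 0 L ∧ s < f x} = {x | s < f x} ∩ Icc 0 L from by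
      ext x; exact and_comm]
  rw [hs]
  have h := isLeast_realRearrangement hf ht
  exact IsLeast.csInf_eq ⟨mem_image_of_mem _ h.1, by
    rintro _ ⟨s, hs, rfl⟩
    exact EReal.coe_le_coe_iff.2 (h.2 hs)⟩

lemma antitoneOn_realRearrangement (hf : AEMeasurable f (volume.restrict (Icc 0 L))) :
    AntitoneOn (realRearrangement L f) (Ioo 0 L) := by
  intro a ha b hb hab
  exact (isLeast_realRearrangement hf hb).2
    ((isLeast_realRearrangement hf ha).1.trans (ENNReal.ofReal_le_ofReal hab))

lemma aemeasurable_realRearrangement (hf : AEMeasurable f (volume.restrict (Icc 0 L))) :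
    AEMeasurable (realRearrangement L f) (volume.restrict (Ioo 0 L)) :=
  aemeasurable_restrict_of_antitoneOn measurableSet_Ioo (antitoneOn_realRearrangement hf)

/-- A function and its decreasing rearrangement are equimeasurable. -/
lemma map_realRearrangement (hf : AEMeasurable f (volume.restrict (Icc 0 L))) :
    Measure.map (realRearrangement L f) (volume.restrict (Ioo 0 L)) =
      Measure.map f (volume.restrict (Icc 0 L)) := by
  have hg := aemeasurable_realRearrangement hf
  have hIoi : ∀ s : ℝ, Measure.map (realRearrangement L f) (volume.restrict (Ioo 0 L)) (Ioi s) =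
      Measure.map f (volume.restrict (Icc 0 L)) (Ioi s) := by
    intro s
    rw [Measure.map_apply_of_aemeasurable hg measurableSet_Ioi,
      Measure.map_apply_of_aemeasurable hf measurableSet_Ioi,
      Measure.restrict_apply' measurableSet_Ioo]
    have hle : distribution L f s ≤ ENNReal.ofReal L := by
      refine (measure_mono (subset_univ _)).trans ?_
      simp
    have htop : distribution L f s ≠ ⊤ := (hle.trans_lt ENNReal.ofReal_lt_top).ne
    -- By `lt_realRearrangement_iff` a superlevel set of the rearrangement is an initial interval
    -- whose length is the distribution function.
    have hset : realRearrangement L f ⁻¹' Ioi s ∩ Ioo 0 L =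
        Ioo 0 (distribution L f s).toReal := by
      ext t
      constructor
      · rintro ⟨h1, h2⟩
        exact ⟨h2.1, (ENNReal.ofReal_lt_iff_lt_toReal h2.1.le htop).1
          ((lt_realRearrangement_iff hf h2).1 h1)⟩
      · rintro ⟨h1, h2⟩
        have h3 := (ENNReal.ofReal_lt_iff_lt_toReal h1.le htop).2 h2
        have h4 : t ∈ Ioo 0 L := by
          refine ⟨h1, ?_⟩
          by_contra! hLt
          exact absurd (h3.trans_le hle) (not_lt.2 (ENNReal.ofReal_le_ofReal hLt))
        exact ⟨(lt_realRearrangement_iff hf h4).2 h3, h4⟩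
    rw [hset, Real.volume_Ioo, sub_zero, ENNReal.ofReal_toReal htop]
    rfl
  have : IsFiniteMeasure (Measure.map (realRearrangement L f) (volume.restrict (Ioo 0 L))) :=
    Measure.isFiniteMeasure_map _ _
  have : IsFiniteMeasure (Measure.map f (volume.restrict (Icc 0 L))) :=
    Measure.isFiniteMeasure_map _ _
  have huniv : Measure.map (realRearrangement L f) (volume.restrict (Ioo 0 L)) univ =
      Measure.map f (volume.restrict (Icc 0 L)) univ := by
    rw [Measure.map_apply_of_aemeasurable hg MeasurableSet.univ,
      Measure.map_apply_of_aemeasurable hf MeasurableSet.univ]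
    simp
  refine Measure.ext_of_Iic _ _ fun s => ?_
  rw [← compl_Ioi, measure_compl measurableSet_Ioi (measure_ne_top _ _),
    measure_compl measurableSet_Ioi (measure_ne_top _ _), hIoi, huniv]

lemma integral_comp_realRearrangement (hf : AEMeasurable f (volume.restrict (Icc 0 L)))
    {φ : ℝ → ℝ} (hφ : Continuous φ) :
    ∫ t in Ioo 0 L, φ (realRearrangement L f t) = ∫ x in Icc 0 L, φ (f x) := by
  rw [← integral_map (aemeasurable_realRearrangement hf) hφ.aestronglyMeasurable,
    map_realRearrangement hf, integral_map hf hφ.aestronglyMeasurable]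

lemma integrableOn_comp_realRearrangement (hf : AEMeasurable f (volume.restrict (Icc 0 L)))
    {φ : ℝ → ℝ} (hφ : Continuous φ) (h : IntegrableOn (fun x => φ (f x)) (Icc 0 L)) :
    IntegrableOn (fun t => φ (realRearrangement L f t)) (Ioo 0 L) := by
  refine (integrable_map_measure (f := realRearrangement L f) hφ.aestronglyMeasurable
    (aemeasurable_realRearrangement hf)).1 ?_
  rw [map_realRearrangement hf]
  exact (integrable_map_measure hφ.aestronglyMeasurable hf).2 h

/-- The bathtub principle: an integral of `f` against a density `0 ≤ g ≤ 1` of mass `m` is at most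
the integral over `(0, m)` of the decreasing rearrangement. -/
lemma integral_mul_le_integral_realRearrangement (hf : IntegrableOn f (Icc 0 L)) {g : ℝ → ℝ}
    (hg : AEStronglyMeasurable g (volume.restrict (Icc 0 L))) (hg0 : ∀ x, 0 ≤ g x)
    (hg1 : ∀ x, g x ≤ 1) {m : ℝ} (hm : m ∈ Ioo 0 L) (hgm : ∫ x in Icc 0 L, g x = m) :
    ∫ x in Icc 0 L, f x * g x ≤ ∫ t in Ioo 0 m, realRearrangement L f t := by
  have hfm : AEMeasurable f (volume.restrict (Icc 0 L)) := hf.1.aemeasurable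
  set F := realRearrangement L f with hF
  set s := F m with hs
  have hgb : ∀ᵐ x ∂(volume.restrict (Icc 0 L)), ‖g x‖ ≤ 1 :=
    ae_of_all _ fun x => by rw [Real.norm_of_nonneg (hg0 x)]; exact hg1 x
  have hgi : IntegrableOn g (Icc 0 L) := (integrable_const (1 : ℝ)).mono' hg hgb
  have hfg : IntegrableOn (fun x => f x * g x) (Icc 0 L) := hf.mul_bdd hg hgb
  have hφ : Continuous fun y : ℝ => max (y - s) 0 := by fun_prop
  have hpos : IntegrableOn (fun x => max (f x - s) 0) (Icc 0 L) :=
    (hf.sub (integrable_const s)).pos_part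
  have hFi : IntegrableOn F (Ioo 0 L) :=
    integrableOn_comp_realRearrangement hfm continuous_id hf
  -- Pointwise `(f - s) g ≤ (f - s)⁺`, as `0 ≤ g ≤ 1`.
  have h1 : ∫ x in Icc 0 L, (f x * g x - s * g x) ≤ ∫ x in Icc 0 L, max (f x - s) 0 := by
    refine integral_mono (hfg.sub (hgi.const_mul s)) hpos fun x => ?_
    have := hg0 x
    have := hg1 x
    rcases le_total (f x) s with h | h
    · simp only [max_eq_right (sub_nonpos.2 h)]
      nlinarith
    · simp only [max_eq_left (sub_nonneg.2 h)]
      nlinarith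
  have h2 : ∫ t in Ioo 0 L, max (F t - s) 0 = ∫ x in Icc 0 L, max (f x - s) 0 :=
    integral_comp_realRearrangement hfm hφ
  have hFp : IntegrableOn (fun t => max (F t - s) 0) (Ioo 0 L) :=
    integrableOn_comp_realRearrangement hfm hφ hpos
  have hanti := antitoneOn_realRearrangement hfm
  -- With `s = F m`, monotonicity gives `F ≥ s` before `m` and `F ≤ s` after it.
  have h3 : ∫ t in Ioo 0 L, max (F t - s) 0 = ∫ t in Ioo 0 m, (F t - s) := by
    rw [setIntegral_eq_of_subset_of_forall_sdiff_eq_zero measurableSet_Ioo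
      (Ioo_subset_Ioo_right hm.2.le : Ioo 0 m ⊆ Ioo 0 L)]
    · refine setIntegral_congr_fun measurableSet_Ioo fun t ht => ?_
      exact max_eq_left (sub_nonneg.2 (hanti ⟨ht.1, ht.2.trans hm.2⟩ hm ht.2.le))
    · rintro t ⟨ht, htm⟩
      have hmt : m ≤ t := by
        by_contra! h
        exact htm ⟨ht.1, h⟩
      exact max_eq_right (sub_nonpos.2 (hanti hm ht hmt))
  have h4 : ∫ t in Ioo 0 m, (F t - s) = (∫ t in Ioo 0 m, F t) - s * m := by
    rw [integral_sub (hFi.mono_set (Ioo_subset_Ioo_right hm.2.le)) (integrable_const s)]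
    simp [hm.1.le, mul_comm]
  rw [integral_sub hfg (hgi.const_mul s), integral_const_mul, hgm] at h1
  linarith

end Rearrangement

/-! ### Weak formulation and energy estimate by truncation. -/

section Neumann

variable {L : ℝ} {u F : ℝ → ℝ} {g : ℝ → EReal}

lemma IsNeumannSolution.deriv_ae_eq (hu : IsNeumannSolution 0 L g u)
    (hg : ∀ x ∈ Ioo 0 L, g x = (F x : EReal)) :
    ∀ᵐ x ∂(volume.restrict (Ioo 0 L)), deriv (derivWithin u (Icc 0 L)) x = -F x := by
  filter_upwards [hu.equation, ae_restrict_mem measurableSet_Ioo] with x ⟨w, hw, hwx⟩ hx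
  rw [hg x hx, EReal.coe_eq_coe_iff] at hwx
  rw [hw.deriv, ← hwx, neg_neg]

lemma IsNeumannSolution.derivWithin_eq (hu : IsNeumannSolution 0 L g u)
    (hg : ∀ x ∈ Ioo 0 L, g x = (F x : EReal)) {x : ℝ} (hx : x ∈ Icc 0 L) :
    derivWithin u (Icc 0 L) x = -∫ t in Ioo 0 x, F t := by
  have hac : AbsolutelyContinuousOnInterval (derivWithin u (Icc 0 L)) 0 x :=
    hu.absolutelyContinuous.mono (by
      rw [uIcc_of_le hx.1, uIcc_of_le (hx.1.trans hx.2)]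
      exact Icc_subset_Icc_right hx.2)
  have h := hac.integral_deriv_eq_sub
  rw [hu.left_boundary, sub_zero, intervalIntegral.integral_of_le hx.1,
    integral_Ioc_eq_integral_Ioo] at h
  rw [← h, ← integral_neg]
  exact integral_congr_ae
    (ae_restrict_of_ae_restrict_of_subset (Ioo_subset_Ioo_right hx.2) (hu.deriv_ae_eq hg))

/-- The weak formulation of the Neumann problem. -/
lemma IsNeumannSolution.integral_mul_eq (hL : 0 < L) (hu : IsNeumannSolution 0 L g u)
    (hg : ∀ x ∈ Ioo 0 L, g x = (F x : EReal)) {h : ℝ → ℝ}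
    (hh : AbsolutelyContinuousOnInterval h 0 L) :
    ∫ x in Icc 0 L, F x * h x = ∫ x in Ioo 0 L, derivWithin u (Icc 0 L) x * deriv h x := by
  have h1 := hu.absolutelyContinuous.integral_mul_deriv_eq_deriv_mul hh
  rw [hu.left_boundary, hu.right_boundary, intervalIntegral.integral_of_le hL.le,
    intervalIntegral.integral_of_le hL.le, integral_Ioc_eq_integral_Ioo,
    integral_Ioc_eq_integral_Ioo] at h1
  rw [h1, integral_Icc_eq_integral_Ioo, zero_mul, zero_mul, sub_zero, zero_sub, ← integral_neg]
  refine integral_congr_ae ?_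
  filter_upwards [hu.deriv_ae_eq hg] with x hx
  rw [hx]
  ring

/-- The function `y` truncated to the interval `[s₀, s₁]`. -/
noncomputable def truncation (s₀ s₁ y : ℝ) : ℝ := max s₀ (min s₁ y)

lemma continuous_truncation (s₀ s₁ : ℝ) : Continuous (truncation s₀ s₁) := by
  unfold truncation
  fun_prop

lemma lipschitzWith_truncation (s₀ s₁ : ℝ) : LipschitzWith 1 (truncation s₀ s₁) :=
  (LipschitzWith.id.const_min s₁).const_max s₀

lemma le_truncation (s₀ s₁ y : ℝ) : s₀ ≤ truncation s₀ s₁ y := le_max_left _ _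

lemma truncation_le {s₀ s₁ : ℝ} (h : s₀ ≤ s₁) (y : ℝ) : truncation s₀ s₁ y ≤ s₁ :=
  max_le h (min_le_left _ _)

lemma truncation_of_le {s₀ s₁ y : ℝ} (h : y ≤ s₀) : truncation s₀ s₁ y = s₀ :=
  max_eq_left ((min_le_right _ _).trans h)

lemma truncation_of_ge {s₀ s₁ y : ℝ} (hs : s₀ ≤ s₁) (h : s₁ ≤ y) : truncation s₀ s₁ y = s₁ := by
  rw [truncation, min_eq_left h, max_eq_right hs]

lemma monotone_truncation (s₀ s₁ : ℝ) : Monotone (truncation s₀ s₁) :=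
  fun _ _ h => max_le_max le_rfl (min_le_min le_rfl h)

/-- Truncation is monotone and 1-Lipschitz. This is the difference form of `H'² ≤ u' H'`. -/
lemma sq_truncation_sub_le (s₀ s₁ y z : ℝ) :
    (truncation s₀ s₁ y - truncation s₀ s₁ z) ^ 2 ≤
      (truncation s₀ s₁ y - truncation s₀ s₁ z) * (y - z) := by
  wlog h : z ≤ y generalizing y z
  · have := this z y (not_le.1 h).le
    nlinarith
  have h1 := monotone_truncation s₀ s₁ h
  have h2 := (lipschitzWith_truncation s₀ s₁).dist_le_mul y z
  rw [Real.dist_eq, Real.dist_eq, abs_of_nonneg (sub_nonneg.2 h1), abs_of_nonneg (sub_nonneg.2 h),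
    NNReal.coe_one, one_mul] at h2
  nlinarith

/-- Passing to the limit in difference quotients avoids a chain rule at the kinks of the truncation.
Where the composite is not differentiable, `deriv` is `0` by convention. -/
lemma sq_deriv_truncation_comp_le (s₀ s₁ : ℝ) {u' x : ℝ} (hu : HasDerivAt u u' x) :
    (deriv (fun y => truncation s₀ s₁ (u y)) x) ^ 2 ≤
      u' * deriv (fun y => truncation s₀ s₁ (u y)) x := by
  by_cases hd : DifferentiableAt ℝ (fun y => truncation s₀ s₁ (u y)) x
  · have h1 := hasDerivAt_iff_tendsto_slope.1 hd.hasDerivAt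
    have h2 := hasDerivAt_iff_tendsto_slope.1 hu
    refine le_of_tendsto_of_tendsto' (h1.pow 2) (h2.mul h1) fun y => ?_
    have := mul_le_mul_of_nonneg_left (sq_truncation_sub_le s₀ s₁ (u y) (u x))
      (sq_nonneg (y - x)⁻¹)
    simp only [slope_def_field, div_eq_mul_inv]
    nlinarith
  · simp [deriv_zero_of_not_differentiableAt hd]

/-- Outside the open band the truncated function is at its global minimum or maximum. -/
lemma deriv_truncation_comp_eq_zero {s₀ s₁ x : ℝ} (hs : s₀ ≤ s₁) (hx : u x ∉ Ioo s₀ s₁) :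
    deriv (fun y => truncation s₀ s₁ (u y)) x = 0 := by
  rcases le_or_gt (u x) s₀ with h | h
  · refine IsLocalMin.deriv_eq_zero (Eventually.of_forall fun y => ?_)
    simp only [truncation_of_le h]
    exact le_truncation _ _ _
  · refine IsLocalMax.deriv_eq_zero (Eventually.of_forall fun y => ?_)
    simp only [truncation_of_ge hs (not_lt.1 fun h' => hx ⟨h, h'⟩)]
    exact truncation_le hs _

lemma IsNeumannSolution.hasDerivAt (hu : IsNeumannSolution 0 L g u) {x : ℝ} (hx : x ∈ Ioo 0 L) :
    HasDerivAt u (derivWithin u (Icc 0 L) x) x :=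
  (hu.contDiffOn.differentiableOn one_ne_zero x
    (Ioo_subset_Icc_self hx)).hasDerivWithinAt.hasDerivAt (Icc_mem_nhds hx.1 hx.2)

lemma IsNeumannSolution.absolutelyContinuousOnInterval_truncation (hL : 0 < L)
    (hu : IsNeumannSolution 0 L g u) (s₀ s₁ : ℝ) :
    AbsolutelyContinuousOnInterval (fun x => truncation s₀ s₁ (u x)) 0 L := by
  obtain ⟨K, hK⟩ := hu.contDiffOn.exists_lipschitzOnWith one_ne_zero (convex_Icc _ _)
    isCompact_Icc
  refine LipschitzOnWith.absolutelyContinuousOnInterval (K := 1 * K) ?_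
  rw [uIcc_of_le hL.le]
  exact (lipschitzWith_truncation s₀ s₁).comp_lipschitzOnWith hK

/-- An energy estimate on the region where `u` lies between two levels. -/
lemma IsNeumannSolution.sq_sub_le (hL : 0 < L) (hu : IsNeumannSolution 0 L g u)
    (hg : ∀ x ∈ Ioo 0 L, g x = (F x : EReal)) {s₀ s₁ d : ℝ} (hs : s₀ < s₁) (hd : 0 < d)
    (hE : volume.real (Ioo 0 L ∩ u ⁻¹' Ioo s₀ s₁) ≤ d) {p q : ℝ} (hp : p ∈ Icc 0 L)
    (hq : q ∈ Icc 0 L) (hup : u p ≤ s₀) (huq : s₁ ≤ u q) :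
    (s₁ - s₀) ^ 2 ≤ d * ∫ x in Icc 0 L, F x * (truncation s₀ s₁ (u x) - s₀) := by
  set H : ℝ → ℝ := fun x => truncation s₀ s₁ (u x) with hH
  have hac : AbsolutelyContinuousOnInterval H 0 L :=
    hu.absolutelyContinuousOnInterval_truncation hL s₀ s₁
  have hac' : AbsolutelyContinuousOnInterval (fun x => H x - s₀) 0 L :=
    hac.sub (LipschitzOnWith.absolutelyContinuousOnInterval
      (LipschitzWith.const s₀).lipschitzOnWith)
  have hweak := hu.integral_mul_eq hL hg hac'
  simp only [deriv_sub_const_fun] at hweak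
  have hint : IntegrableOn (deriv H) (Ioo 0 L) := by
    have := hac.intervalIntegrable_deriv
    rw [intervalIntegrable_iff_integrableOn_Ioo_of_le hL.le] at this
    exact this
  set u' := derivWithin u (Icc 0 L) with hu'
  have hu'c : ContinuousOn u' (Icc 0 L) := by
    have := hu.absolutelyContinuous.continuousOn
    rwa [uIcc_of_le hL.le] at this
  have hint2 : IntegrableOn (fun x => u' x * deriv H x) (Ioo 0 L) := by
    have := (hac.intervalIntegrable_deriv).continuousOn_mul
      (g := u') (by rwa [uIcc_of_le hL.le])
    rwa [intervalIntegrable_iff_integrableOn_Ioo_of_le hL.le] at this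
  have hEo : IsOpen (Ioo 0 L ∩ u ⁻¹' Ioo s₀ s₁) :=
    (hu.contDiffOn.continuousOn.mono Ioo_subset_Icc_self).isOpen_inter_preimage isOpen_Ioo
      isOpen_Ioo
  set E := Ioo 0 L ∩ u ⁻¹' Ioo s₀ s₁ with hEdef
  have hEm := hEo.measurableSet
  -- The weight in `|H'| ≤ H'² / (2 lam) + lam / 2`, a pointwise substitute for Cauchy–Schwarz. With
  -- this choice the last term integrates to at most `(s₁ - s₀) / 2` and is absorbed on the left.
  set lam := (s₁ - s₀) / d with hlam
  have hε : 0 < s₁ - s₀ := sub_pos.2 hs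
  have hlam0 : 0 < lam := div_pos hε hd
  have hpt : ∀ x ∈ Ioo 0 L, |deriv H x| ≤
      (2 * lam)⁻¹ * (u' x * deriv H x) + lam / 2 * E.indicator 1 x := by
    intro x hx
    by_cases hxE : u x ∈ Ioo s₀ s₁
    · have h1 := sq_deriv_truncation_comp_le s₀ s₁ (hu.hasDerivAt hx)
      have h2 : E.indicator (1 : ℝ → ℝ) x = 1 := indicator_of_mem (show x ∈ E from ⟨hx, hxE⟩) 1
      rw [h2]
      have h3 : |deriv H x| ≤ (2 * lam)⁻¹ * (deriv H x) ^ 2 + lam / 2 * 1 := by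
        rw [← sq_abs]
        have : (2 * lam)⁻¹ * |deriv H x| ^ 2 + lam / 2 * 1 - |deriv H x| =
            (2 * lam)⁻¹ * (|deriv H x| - lam) ^ 2 := by
          field_simp
          ring
        have : 0 ≤ (2 * lam)⁻¹ * (|deriv H x| - lam) ^ 2 := by positivity
        linarith
      refine h3.trans ?_
      gcongr
    · have h1 : deriv H x = 0 := deriv_truncation_comp_eq_zero hs.le hxE
      have h2 : E.indicator (1 : ℝ → ℝ) x = 0 := indicator_of_notMem (fun h => hxE h.2) 1
      simp [h1, h2]
  have hind : IntegrableOn (E.indicator (1 : ℝ → ℝ)) (Ioo 0 L) :=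
    (integrable_const (1 : ℝ)).indicator hEm
  have hmain : ∫ x in Ioo 0 L, |deriv H x| ≤
      (2 * lam)⁻¹ * (∫ x in Ioo 0 L, u' x * deriv H x) + lam / 2 * volume.real E := by
    have h1 := setIntegral_mono_on hint.abs ((hint2.const_mul (2 * lam)⁻¹).add
      (hind.const_mul (lam / 2))) measurableSet_Ioo hpt
    rw [integral_add' (hint2.const_mul _) (hind.const_mul _), integral_const_mul,
      integral_const_mul] at h1
    rw [integral_indicator_one hEm] at h1
    rwa [measureReal_restrict_apply hEm, inter_eq_left.2 inter_subset_left] at h1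
  have hcross : s₁ - s₀ ≤ ∫ x in Ioo 0 L, |deriv H x| := by
    have hsub : uIcc p q ⊆ Icc 0 L := uIcc_subset_Icc hp hq
    have hpq := (hac.mono (by rwa [uIcc_of_le hL.le] : uIcc p q ⊆ uIcc 0 L)).integral_deriv_eq_sub
    have h1 : H q - H p = s₁ - s₀ := by
      simp only [hH, truncation_of_le hup, truncation_of_ge hs.le huq]
    rw [h1] at hpq
    calc s₁ - s₀ ≤ ‖∫ x in p..q, deriv H x‖ := by rw [hpq]; exact le_abs_self _
      _ ≤ ∫ x in uIoc p q, ‖deriv H x‖ := intervalIntegral.norm_integral_le_integral_norm_uIoc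
      _ ≤ ∫ x in Ioc 0 L, ‖deriv H x‖ := by
        refine setIntegral_mono_set ?_ (ae_of_all _ fun x => norm_nonneg _) ?_
        · rw [integrableOn_Ioc_iff_integrableOn_Ioo]
          exact hint.norm
        · refine (Eventually.of_forall ?_)
          intro x hx
          exact ⟨(le_min hp.1 hq.1).trans_lt hx.1, hx.2.trans (max_le hp.2 hq.2)⟩
      _ = ∫ x in Ioo 0 L, |deriv H x| := by
        rw [integral_Ioc_eq_integral_Ioo]
        rfl
  rw [hweak]
  set I := ∫ x in Ioo 0 L, u' x * deriv H x with hI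
  have h1 : s₁ - s₀ ≤ (2 * lam)⁻¹ * I + lam / 2 * d := by
    refine (hcross.trans hmain).trans ?_
    gcongr
  have h2 : (2 * lam)⁻¹ * I + lam / 2 * d = d / (2 * (s₁ - s₀)) * I + (s₁ - s₀) / 2 := by
    rw [hlam]
    field_simp
  rw [h2] at h1
  have h3 : (s₁ - s₀) / 2 ≤ d * I / (2 * (s₁ - s₀)) := by
    have : d / (2 * (s₁ - s₀)) * I = d * I / (2 * (s₁ - s₀)) := by ring
    linarith
  rw [le_div_iff₀ (by positivity)] at h3
  nlinarith

end Neumann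

/-! ### Comparing the decay of `v` with that of the rearranged `u`. -/

section Comparison

variable {L : ℝ} {f u v : ℝ → ℝ} {g : ℝ → EReal}

lemma IsNeumannSolution.continuousOn (hu : IsNeumannSolution 0 L g u) :
    ContinuousOn u (Icc 0 L) :=
  hu.contDiffOn.continuousOn

lemma IsNeumannSolution.aemeasurable (hu : IsNeumannSolution 0 L g u) :
    AEMeasurable u (volume.restrict (Icc 0 L)) :=
  hu.continuousOn.aemeasurable measurableSet_Icc

lemma exists_realRearrangement_le (hu : ContinuousOn u (Icc 0 L)) {t : ℝ} (ht : t ∈ Ioo 0 L) :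
    ∃ x ∈ Icc 0 L, realRearrangement L u t ≤ u x := by
  have hum : AEMeasurable u (volume.restrict (Icc 0 L)) := hu.aemeasurable measurableSet_Icc
  obtain ⟨x, hx, hmax⟩ := isCompact_Icc.exists_isMaxOn
    (nonempty_Icc.2 (ht.1.trans ht.2).le) hu
  refine ⟨x, hx, (isLeast_realRearrangement hum ht).2 ?_⟩
  have h0 : distribution L u (u x) = 0 := by
    rw [distribution, Measure.restrict_apply' measurableSet_Icc]
    rw [show {y | u x < u y} ∩ Icc 0 L = ∅ from ?_, measure_empty]
    ext y
    simp only [mem_inter_iff, mem_ofPred_eq, mem_empty_iff_false, iff_false, not_and]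
    exact fun h hy => absurd (hmax hy) (not_le.2 h)
  simp [h0]

lemma exists_le_realRearrangement (hu : AEMeasurable u (volume.restrict (Icc 0 L))) {t : ℝ}
    (ht : t ∈ Ioo 0 L) : ∃ x ∈ Icc 0 L, u x ≤ realRearrangement L u t := by
  by_contra! h
  have h1 := (isLeast_realRearrangement hu ht).1
  have h2 : distribution L u (realRearrangement L u t) = ENNReal.ofReal L := by
    rw [distribution, Measure.restrict_apply' measurableSet_Icc,
      inter_eq_right.2 (show Icc 0 L ⊆ {x | realRearrangement L u t < u x} from h),
      Real.volume_Icc, sub_zero]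
  simp only [mem_ofPred_eq] at h1
  rw [h2, ENNReal.ofReal_le_ofReal_iff ht.1.le] at h1
  exact absurd ht.2 (not_lt.2 h1)

/-- Bathtub principle with the constant density `t / L`. -/
lemma integral_realRearrangement_nonneg (hf : IntegrableOn f (Icc 0 L))
    (hf0 : ∫ x in Icc 0 L, f x = 0) {t : ℝ} (ht : t ∈ Ioo 0 L) :
    0 ≤ ∫ s in Ioo 0 t, realRearrangement L f s := by
  have hL : 0 < L := ht.1.trans ht.2
  have h := integral_mul_le_integral_realRearrangement hf (g := fun _ => t / L)
    aestronglyMeasurable_const (fun _ => (div_pos ht.1 hL).le)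
    (fun _ => (div_le_one hL).2 ht.2.le) ht (by
      rw [setIntegral_const, measureReal_def, Real.volume_Icc, sub_zero,
        ENNReal.toReal_ofReal hL.le, smul_eq_mul]
      field_simp)
  rwa [integral_mul_const, hf0, zero_mul] at h

/-- By equimeasurability `u` may be replaced by its rearrangement, which by monotonicity lies
strictly between the two levels only at points of `(a, b)`. -/
lemma volume_real_level_le (hu : AEMeasurable u (volume.restrict (Icc 0 L))) {a b : ℝ}
    (ha : a ∈ Ioo 0 L) (hb : b ∈ Ioo 0 L) (hab : a ≤ b) :
    volume.real (Ioo 0 L ∩ u ⁻¹' Ioo (realRearrangement L u b) (realRearrangement L u a)) ≤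
      b - a := by
  set s₀ := realRearrangement L u b
  set s₁ := realRearrangement L u a
  have hanti := antitoneOn_realRearrangement hu
  have h1 : volume (Ioo 0 L ∩ u ⁻¹' Ioo s₀ s₁) ≤ ENNReal.ofReal (b - a) :=
    calc volume (Ioo 0 L ∩ u ⁻¹' Ioo s₀ s₁)
        ≤ volume.restrict (Icc 0 L) (u ⁻¹' Ioo s₀ s₁) := by
          rw [Measure.restrict_apply' measurableSet_Icc, inter_comm]
          exact measure_mono (inter_subset_inter_right _ Ioo_subset_Icc_self)
      _ = volume.restrict (Ioo 0 L) (realRearrangement L u ⁻¹' Ioo s₀ s₁) := by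
          rw [← Measure.map_apply_of_aemeasurable hu measurableSet_Ioo,
            ← map_realRearrangement hu,
            Measure.map_apply_of_aemeasurable (aemeasurable_realRearrangement hu)
              measurableSet_Ioo]
      _ ≤ volume (Ioo a b) := by
          rw [Measure.restrict_apply' measurableSet_Ioo]
          refine measure_mono ?_
          rintro t ⟨⟨ht0, ht1⟩, ht⟩
          constructor
          · by_contra! h
            exact absurd (hanti ht ha h) (not_le.2 ht1)
          · by_contra! h
            exact absurd (hanti hb ht h) (not_le.2 ht0)
      _ = ENNReal.ofReal (b - a) := Real.volume_Ioo
  exact ENNReal.toReal_le_of_le_ofReal (sub_nonneg.2 hab) h1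

/-- After passing to the rearrangement, the integrand is `1` on `(0, a)`, vanishes from `b` on, and
stays in `[0, 1]` in between. -/
lemma integral_normalized_truncation_mem_Icc (hu : AEMeasurable u (volume.restrict (Icc 0 L)))
    {a b : ℝ} (ha : a ∈ Ioo 0 L) (hb : b ∈ Ioo 0 L)
    (hs : realRearrangement L u b < realRearrangement L u a) :
    ∫ x in Icc 0 L, (truncation (realRearrangement L u b) (realRearrangement L u a) (u x) -
      realRearrangement L u b) / (realRearrangement L u a - realRearrangement L u b) ∈
      Icc a b := by
  set s₀ := realRearrangement L u b with hs₀
  set s₁ := realRearrangement L u a with hs₁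
  have hε : 0 < s₁ - s₀ := sub_pos.2 hs
  have hanti := antitoneOn_realRearrangement hu
  set η : ℝ → ℝ := fun y => (truncation s₀ s₁ y - s₀) / (s₁ - s₀) with hη
  have hηc : Continuous η := ((continuous_truncation s₀ s₁).sub continuous_const).div_const _
  have hη0 : ∀ y, 0 ≤ η y := fun y => div_nonneg (sub_nonneg.2 (le_truncation _ _ _)) hε.le
  have hη1 : ∀ y, η y ≤ 1 := fun y =>
    (div_le_one hε).2 (sub_le_sub_right (truncation_le hs.le y) _)
  rw [show ∫ x in Icc 0 L, (truncation s₀ s₁ (u x) - s₀) / (s₁ - s₀) =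
    ∫ t in Ioo 0 L, η (realRearrangement L u t) from
      (integral_comp_realRearrangement hu hηc).symm]
  have hint : IntegrableOn (fun t => η (realRearrangement L u t)) (Ioo 0 L) :=
    (integrable_const (1 : ℝ)).mono'
      (hηc.measurable.comp_aemeasurable (aemeasurable_realRearrangement hu)).aestronglyMeasurable
      (ae_of_all _ fun t => by rw [Real.norm_of_nonneg (hη0 _)]; exact hη1 _)
  have hconst : ∀ c : ℝ, 0 < c → ∫ _ in Ioo 0 c, (1 : ℝ) = c := fun c hc => by
    simp [hc.le]
  constructor
  · calc a = ∫ t in Ioo 0 a, (1 : ℝ) := (hconst a ha.1).symm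
      _ = ∫ t in Ioo 0 a, η (realRearrangement L u t) := by
          refine setIntegral_congr_fun measurableSet_Ioo fun t ht => ?_
          have := hanti ⟨ht.1, ht.2.trans ha.2⟩ ha ht.2.le
          simp only [hη, truncation_of_ge hs.le this, div_self hε.ne']
      _ ≤ ∫ t in Ioo 0 L, η (realRearrangement L u t) :=
          setIntegral_mono_set hint (ae_of_all _ fun t => hη0 _)
            (Ioo_subset_Ioo_right ha.2.le).eventuallyLE
  · calc ∫ t in Ioo 0 L, η (realRearrangement L u t)
        = ∫ t in Ioo 0 b, η (realRearrangement L u t) := by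
          refine setIntegral_eq_of_subset_of_forall_sdiff_eq_zero measurableSet_Ioo
            (Ioo_subset_Ioo_right hb.2.le) ?_
          rintro t ⟨ht, htb⟩
          have hbt : b ≤ t := by
            by_contra! h
            exact htb ⟨ht.1, h⟩
          have : realRearrangement L u t ≤ s₀ := hanti hb ht hbt
          simp only [hη, truncation_of_le this, sub_self, zero_div]
      _ ≤ ∫ t in Ioo 0 b, (1 : ℝ) :=
          setIntegral_mono (hint.mono_set (Ioo_subset_Ioo_right hb.2.le)) (integrable_const _)
            fun t => hη1 _
      _ = b := hconst b hb.1

/-- The rearrangement of a Neumann solution decreases at most as fast as the rearrangement of the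
right-hand side allows. -/
lemma exists_realRearrangement_sub_le (hf : IntegrableOn f (Icc 0 L))
    (hf0 : ∫ x in Icc 0 L, f x = 0)
    (hu : IsNeumannSolution 0 L (fun x => (f x : EReal)) u) {a b : ℝ} (ha : a ∈ Ioo 0 L)
    (hb : b ∈ Ioo 0 L) (hab : a < b) :
    ∃ m ∈ Icc a b, realRearrangement L u a - realRearrangement L u b ≤
      (∫ t in Ioo 0 m, realRearrangement L f t) * (b - a) := by
  have hL : 0 < L := ha.1.trans ha.2
  have hba : 0 < b - a := sub_pos.2 hab
  rcases le_or_gt (realRearrangement L u a) (realRearrangement L u b) with h | hs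
  · refine ⟨a, left_mem_Icc.2 hab.le, (sub_nonpos.2 h).trans ?_⟩
    exact mul_nonneg (integral_realRearrangement_nonneg hf hf0 ha) hba.le
  have hum := hu.aemeasurable
  have hm := integral_normalized_truncation_mem_Icc hum ha hb hs
  have hE := volume_real_level_le hum ha hb hab.le
  obtain ⟨q, hq, hq'⟩ := exists_realRearrangement_le hu.continuousOn ha
  obtain ⟨p, hp, hp'⟩ := exists_le_realRearrangement hum hb
  set s₀ := realRearrangement L u b with hs₀
  set s₁ := realRearrangement L u a with hs₁
  have hε : 0 < s₁ - s₀ := sub_pos.2 hs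
  -- The witness is the mass of the normalized truncation.
  refine ⟨_, hm, ?_⟩
  have henergy := hu.sq_sub_le hL (fun _ _ => rfl) hs hba hE hp hq hp' hq'
  have hbath := integral_mul_le_integral_realRearrangement hf
    (g := fun x => (truncation s₀ s₁ (u x) - s₀) / (s₁ - s₀))
    ((((continuous_truncation s₀ s₁).measurable.comp_aemeasurable hum).sub_const s₀).div_const
      (s₁ - s₀)).aestronglyMeasurable
    (fun x => div_nonneg (sub_nonneg.2 (le_truncation _ _ _)) hε.le)
    (fun x => (div_le_one hε).2 (sub_le_sub_right (truncation_le hs.le _) _))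
    ⟨ha.1.trans_le hm.1, hm.2.trans_lt hb.2⟩ rfl
  simp_rw [← mul_div_assoc] at hbath
  rw [integral_div, div_le_iff₀ hε] at hbath
  have h1 := henergy.trans (mul_le_mul_of_nonneg_left hbath hba.le)
  have h2 : (s₁ - s₀) * (s₁ - s₀) ≤
      ((∫ t in Ioo 0 (∫ x in Icc 0 L, (truncation s₀ s₁ (u x) - s₀) / (s₁ - s₀)),
        realRearrangement L f t) * (b - a)) * (s₁ - s₀) := by
    linarith
  exact le_of_mul_le_mul_right h2 hε

/-- The difference between `v` and the rearrangement of `u` is decreasing. -/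
lemma antitoneOn_sub_realRearrangement (hf : IntegrableOn f (Icc 0 L))
    (hf0 : ∫ x in Icc 0 L, f x = 0)
    (hu : IsNeumannSolution 0 L (fun x => (f x : EReal)) u)
    (hv : IsNeumannSolution 0 L (decreasingRearrangement (Icc 0 L) f) v) :
    AntitoneOn (fun t => v t - realRearrangement L u t) (Ioo 0 L) := by
  intro a ha b hb hab
  have hfm := hf.1.aemeasurable
  set U := realRearrangement L u with hU
  set V : ℝ → ℝ := fun m => -derivWithin v (Icc 0 L) m with hV
  have hVeq : ∀ m ∈ Icc 0 L, ∫ t in Ioo 0 m, realRearrangement L f t = V m := fun m hm => by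
    rw [hV]
    simp only
    rw [hv.derivWithin_eq (fun x hx => decreasingRearrangement_eq_coe hfm hx) hm, neg_neg]
  have hsub : Icc a b ⊆ Ioo 0 L := Icc_subset_Ioo ha.1 hb.2
  have hVc : ContinuousOn V (Icc a b) := by
    have := hv.absolutelyContinuous.continuousOn
    rw [uIcc_of_le (ha.1.trans ha.2).le] at this
    exact (this.mono (hsub.trans Ioo_subset_Icc_self)).neg
  have hkey : ∀ x ∈ Icc a b, ∀ y ∈ Icc a b, x < y →
      ∃ m ∈ Icc x y, U x - U y ≤ V m * (y - x) := fun x hx y hy hxy => by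
    obtain ⟨m, hm, h⟩ := exists_realRearrangement_sub_le hf hf0 hu (hsub hx) (hsub hy) hxy
    rw [hVeq m ⟨(hsub hx).1.le.trans hm.1, hm.2.trans (hsub hy).2.le⟩] at h
    exact ⟨m, hm, h⟩
  obtain ⟨C, hC⟩ := isCompact_Icc.exists_bound_of_continuousOn hVc
  -- A rearrangement may jump in general; here `hkey` and a bound on `V` make `U` Lipschitz.
  have hUc : ContinuousOn U (Icc a b) := by
    refine (LipschitzOnWith.of_le_add_mul C.toNNReal fun x hx y hy => ?_).continuousOn
    rcases le_or_gt y x with h | h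
    · have := antitoneOn_realRearrangement hu.aemeasurable (hsub hy) (hsub hx) h
      have h2 : 0 ≤ (C.toNNReal : ℝ) * dist x y := by positivity
      linarith
    · obtain ⟨m, hm, h'⟩ := hkey x hx y hy h
      have h1 := hC m ⟨hx.1.trans hm.1, hm.2.trans hy.2⟩
      have h2 : V m ≤ (C.toNNReal : ℝ) :=
        ((le_abs_self _).trans h1).trans (Real.le_coe_toNNReal C)
      rw [Real.dist_eq, abs_of_neg (sub_neg.2 h)]
      have := mul_le_mul_of_nonneg_right h2 (sub_pos.2 h).le
      linarith
  have hvc : ContinuousOn v (Icc a b) :=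
    hv.continuousOn.mono (hsub.trans Ioo_subset_Icc_self)
  -- Dini-derivative comparison of `-U` with `-v` shifted to agree with it at `a`. The intermediate
  -- points `m` are squeezed to `x`, so continuity of `V` bounds the right slopes of `-U`.
  have hmain := image_le_of_liminf_slope_right_le_deriv_boundary (f := fun t => -U t)
    (B := fun t => (v a - U a) - v t) (B' := V) (a := a) (b := b) hUc.neg (by simp)
    (continuousOn_const.sub hvc)
    (fun x hx => by
      have h := (hv.hasDerivAt (hsub (Ico_subset_Icc_self hx))).const_sub (v a - U a)
      exact h.hasDerivWithinAt)
    (fun x hx r hr => by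
      have hcont : ContinuousWithinAt V (Icc x b) x :=
        (hVc x (Ico_subset_Icc_self hx)).mono (Icc_subset_Icc_left hx.1)
      have hev := hcont.eventually (gt_mem_nhds hr)
      rw [nhdsWithin_Icc_eq_nhdsGE hx.2] at hev
      obtain ⟨c, hc, hcr⟩ := (mem_nhdsGE_iff_exists_Icc_subset).1 hev
      have hmem : Ioo x (min b c) ∈ 𝓝[>] x := Ioo_mem_nhdsGT (lt_min hx.2 hc)
      refine Eventually.frequently ?_
      filter_upwards [hmem] with z hz
      have hzb : z < b := hz.2.trans_le (min_le_left _ _)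
      have hzc : z < c := hz.2.trans_le (min_le_right _ _)
      obtain ⟨m, hm, h⟩ := hkey x (Ico_subset_Icc_self hx) z
        ⟨hx.1.trans hz.1.le, hzb.le⟩ hz.1
      have hmr : V m < r := hcr ⟨hm.1, hm.2.trans hzc.le⟩
      rw [slope_def_field, div_lt_iff₀ (sub_pos.2 hz.1)]
      have := mul_lt_mul_of_pos_right hmr (sub_pos.2 hz.1)
      linarith)
  have := hmain (right_mem_Icc.2 hab)
  simp only at this ⊢
  linarith

end Comparison

/-! ### From a decreasing difference to convex domination. -/

section Majorization

/-- The right derivative is a subgradient, since it separates the slopes to the left of `x` from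
those to the right. -/
lemma ConvexOn.rightDeriv_mul_sub_le {φ : ℝ → ℝ} (hφ : ConvexOn ℝ univ φ) (x y : ℝ) :
    derivWithin φ (Ioi x) x * (y - x) ≤ φ y - φ x := by
  have hint : ∀ z : ℝ, z ∈ interior (univ : Set ℝ) := fun z => by simp
  rcases lt_trichotomy x y with h | rfl | h
  · have := hφ.rightDeriv_le_slope_of_mem_interior (hint x) (mem_univ y) h
    rwa [slope_def_field, le_div_iff₀ (sub_pos.2 h)] at this
  · simp
  · have h1 := (hφ.slope_le_leftDeriv_of_mem_interior (mem_univ y) (hint x) h).trans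
      (hφ.leftDeriv_le_rightDeriv_of_mem_interior (hint x))
    rw [slope_def_field, div_le_iff₀ (sub_pos.2 h)] at h1
    linarith

/-- Chebyshev's inequality for two decreasing functions, one of which has mean zero. -/
lemma integral_mul_nonneg_of_antitoneOn {L : ℝ} {A D : ℝ → ℝ} (hA : AntitoneOn A (Ioo 0 L))
    (hD : AntitoneOn D (Ioo 0 L)) (hDi : IntegrableOn D (Ioo 0 L))
    (hD0 : ∫ t in Ioo 0 L, D t = 0) {c C : ℝ} (hAb : ∀ t ∈ Ioo 0 L, A t ∈ Icc c C) :
    IntegrableOn (fun t => A t * D t) (Ioo 0 L) ∧ 0 ≤ ∫ t in Ioo 0 L, A t * D t := by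
  have hint : IntegrableOn (fun t => A t * D t) (Ioo 0 L) := by
    refine hDi.bdd_mul (c := max |c| |C|)
      (aemeasurable_restrict_of_antitoneOn measurableSet_Ioo hA).aestronglyMeasurable ?_
    filter_upwards [ae_restrict_mem measurableSet_Ioo] with t ht
    exact abs_le_max_abs_abs (hAb t ht).1 (hAb t ht).2
  refine ⟨hint, ?_⟩
  -- `D` changes sign at most once; `k` is a value separating `A` where `D > 0` from `A` where `D ≤
  -- 0`. Subtracting `k` leaves the integral unchanged because `D` has mean zero.
  obtain ⟨k, hk⟩ : ∃ k, ∀ t ∈ Ioo 0 L, 0 ≤ (A t - k) * D t := by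
    by_cases hne : ∃ t ∈ Ioo 0 L, 0 < D t
    · have hbdd : BddBelow (A '' {t | t ∈ Ioo 0 L ∧ 0 < D t}) := by
        refine ⟨c, ?_⟩
        rintro _ ⟨t, ht, rfl⟩
        exact (hAb t ht.1).1
      have hne' : (A '' {t | t ∈ Ioo 0 L ∧ 0 < D t}).Nonempty := Set.Nonempty.image _ hne
      refine ⟨sInf (A '' {t | t ∈ Ioo 0 L ∧ 0 < D t}), fun t ht => ?_⟩
      rcases lt_or_ge 0 (D t) with h | h
      · exact mul_nonneg (sub_nonneg.2 (csInf_le hbdd ⟨t, ⟨ht, h⟩, rfl⟩)) h.le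
      · refine mul_nonneg_of_nonpos_of_nonpos (sub_nonpos.2 (le_csInf hne' ?_)) h
        rintro _ ⟨s, ⟨hs, hs'⟩, rfl⟩
        refine hA hs ht ?_
        by_contra! hts
        exact absurd (hD ht hs hts.le) (not_le.2 (h.trans_lt hs'))
    · push Not at hne
      exact ⟨C, fun t ht => mul_nonneg_of_nonpos_of_nonpos (sub_nonpos.2 (hAb t ht).2) (hne t ht)⟩
  have h1 : 0 ≤ ∫ t in Ioo 0 L, (A t - k) * D t :=
    setIntegral_nonneg measurableSet_Ioo hk
  simp_rw [sub_mul] at h1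
  rwa [integral_sub hint (hDi.const_mul k), integral_const_mul, hD0, mul_zero, sub_zero] at h1

variable {L : ℝ} {f u v : ℝ → ℝ}

lemma ConvexOn.continuous_of_univ {φ : ℝ → ℝ} (hφ : ConvexOn ℝ univ φ) : Continuous φ :=
  continuousOn_univ.1 (hφ.continuousOn isOpen_univ)

/-- If `v` minus the decreasing rearrangement of `u` is decreasing with mean zero, then `v`
majorizes `u`. -/
lemma integral_convex_comp_le (hu : ContinuousOn u (Icc 0 L)) (hv : ContinuousOn v (Icc 0 L))
    (hanti : AntitoneOn (fun t => v t - realRearrangement L u t) (Ioo 0 L))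
    (hmean : ∫ x in Icc 0 L, u x = ∫ x in Icc 0 L, v x) {φ : ℝ → ℝ} (hφ : ConvexOn ℝ univ φ) :
    ∫ x in Icc 0 L, φ (u x) ≤ ∫ x in Icc 0 L, φ (v x) := by
  have hφc := hφ.continuous_of_univ
  have hum : AEMeasurable u (volume.restrict (Icc 0 L)) := hu.aemeasurable measurableSet_Icc
  have hui : IntegrableOn u (Icc 0 L) := hu.integrableOn_Icc
  have hvi : IntegrableOn v (Icc 0 L) := hv.integrableOn_Icc
  have hφu : IntegrableOn (fun x => φ (u x)) (Icc 0 L) := (hφc.comp_continuousOn hu).integrableOn_Icc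
  have hφv : IntegrableOn (fun x => φ (v x)) (Icc 0 L) := (hφc.comp_continuousOn hv).integrableOn_Icc
  set U := realRearrangement L u with hU
  have hUi : IntegrableOn U (Ioo 0 L) := integrableOn_comp_realRearrangement hum continuous_id hui
  have hφU : IntegrableOn (fun t => φ (U t)) (Ioo 0 L) :=
    integrableOn_comp_realRearrangement hum hφc hφu
  have hvi' := hvi.mono_set Ioo_subset_Icc_self
  have hφv' := hφv.mono_set Ioo_subset_Icc_self
  have hD0 : ∫ t in Ioo 0 L, (v t - U t) = 0 := by
    rw [integral_sub hvi' hUi, ← integral_Icc_eq_integral_Ioo, ← hmean, sub_eq_zero]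
    exact (integral_comp_realRearrangement hum continuous_id).symm
  set ψ : ℝ → ℝ := fun x => derivWithin φ (Ioi x) x with hψ
  have hψm : Monotone ψ := fun x y hxy =>
    hφ.monotoneOn_rightDeriv (by simp) (by simp) hxy
  obtain ⟨B, hB⟩ := isCompact_Icc.exists_bound_of_continuousOn hu
  have hUb : ∀ t ∈ Ioo 0 L, U t ∈ Icc (-B) B := fun t ht => by
    obtain ⟨x, hx, hx'⟩ := exists_realRearrangement_le hu ht
    obtain ⟨y, hy, hy'⟩ := exists_le_realRearrangement hum ht
    exact ⟨(abs_le.1 (hB y hy)).1.trans hy', hx'.trans (abs_le.1 (hB x hx)).2⟩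
  obtain ⟨hAD, hpos⟩ := integral_mul_nonneg_of_antitoneOn (A := fun t => ψ (U t))
    (fun s hs t ht hst => hψm (antitoneOn_realRearrangement hum hs ht hst)) hanti
    (hvi'.sub hUi) hD0 (c := ψ (-B)) (C := ψ B)
    (fun t ht => ⟨hψm (hUb t ht).1, hψm (hUb t ht).2⟩)
  have h1 : ∫ t in Ioo 0 L, ψ (U t) * (v t - U t) ≤ ∫ t in Ioo 0 L, (φ (v t) - φ (U t)) :=
    integral_mono hAD (hφv'.sub hφU) fun t => hφ.rightDeriv_mul_sub_le (U t) (v t)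
  rw [integral_sub hφv' hφU] at h1
  rw [← integral_comp_realRearrangement hum hφc, integral_Icc_eq_integral_Ioo]
  linarith

end Majorization

/-! ### Norms and extrema from special convex functions. -/

section Consequences

variable {L : ℝ} {u v : ℝ → ℝ}

/-- Used with a `φ` vanishing on the range of `v`: one-sided bounds on `v` thereby pass to `u`. -/
lemma ae_comp_eq_zero_of_convex_dominated (hu : ContinuousOn u (Icc 0 L))
    (h : ∀ φ : ℝ → ℝ, ConvexOn ℝ univ φ →
      ∫ x in Icc 0 L, φ (u x) ≤ ∫ x in Icc 0 L, φ (v x))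
    {φ : ℝ → ℝ} (hφ : ConvexOn ℝ univ φ) (hφ0 : ∀ y, 0 ≤ φ y)
    (hv : ∀ᵐ x ∂(volume.restrict (Icc 0 L)), φ (v x) = 0) :
    ∀ᵐ x ∂(volume.restrict (Icc 0 L)), φ (u x) = 0 := by
  have h1 := h φ hφ
  rw [integral_congr_ae hv, integral_zero] at h1
  exact (integral_eq_zero_iff_of_nonneg (fun x => hφ0 _)
    (hφ.continuous_of_univ.comp_continuousOn hu).integrableOn_Icc).1
    (h1.antisymm (integral_nonneg fun x => hφ0 _))

lemma comp_eq_zero_of_convex_dominated (hL : 0 < L) (hu : ContinuousOn u (Icc 0 L))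
    (h : ∀ φ : ℝ → ℝ, ConvexOn ℝ univ φ →
      ∫ x in Icc 0 L, φ (u x) ≤ ∫ x in Icc 0 L, φ (v x))
    {φ : ℝ → ℝ} (hφ : ConvexOn ℝ univ φ) (hφ0 : ∀ y, 0 ≤ φ y)
    (hv : ∀ x ∈ Icc 0 L, φ (v x) = 0) {x : ℝ} (hx : x ∈ Icc 0 L) : φ (u x) = 0 :=
  Measure.eqOn_Icc_of_ae_eq volume hL.ne
    (ae_comp_eq_zero_of_convex_dominated hu h hφ hφ0
      ((ae_restrict_mem measurableSet_Icc).mono hv))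
    (hφ.continuous_of_univ.comp_continuousOn hu) continuousOn_const hx

lemma convexOn_abs_rpow {p : ℝ} (hp : 1 ≤ p) : ConvexOn ℝ univ fun y : ℝ => ‖y‖ ^ p := by
  refine ⟨convex_univ, fun x _ y _ a b ha hb hab => ?_⟩
  have h1 : ‖a • x + b • y‖ ≤ a • ‖x‖ + b • ‖y‖ :=
    convexOn_univ_norm.2 (mem_univ x) (mem_univ y) ha hb hab
  exact (Real.rpow_le_rpow (norm_nonneg _) h1 (by linarith)).trans
    ((convexOn_rpow hp).2 (norm_nonneg x) (norm_nonneg y) ha hb hab)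

lemma memLp_of_continuousOn_Icc (hu : ContinuousOn u (Icc 0 L)) (p : ENNReal) :
    MemLp u p (volume.restrict (Icc 0 L)) := by
  obtain ⟨B, hB⟩ := isCompact_Icc.exists_bound_of_continuousOn hu
  exact MemLp.of_bound (hu.aestronglyMeasurable measurableSet_Icc) B
    ((ae_restrict_mem measurableSet_Icc).mono hB)

/-- The test function is `‖y‖ ^ p` for finite `p`, and `(‖y‖ - C)⁺` with `C` the sup norm of `v` for
`p = ⊤`. -/
lemma eLpNorm_le_of_convex_dominated (hu : ContinuousOn u (Icc 0 L))
    (hv : ContinuousOn v (Icc 0 L))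
    (h : ∀ φ : ℝ → ℝ, ConvexOn ℝ univ φ →
      ∫ x in Icc 0 L, φ (u x) ≤ ∫ x in Icc 0 L, φ (v x)) {p : ENNReal} (hp : 1 ≤ p) :
    eLpNorm u p (volume.restrict (Icc 0 L)) ≤ eLpNorm v p (volume.restrict (Icc 0 L)) := by
  rcases eq_or_ne p ⊤ with rfl | hp'
  · have hfin := (memLp_of_continuousOn_Icc hv ⊤).eLpNorm_ne_top
    set C := (eLpNorm v ⊤ (volume.restrict (Icc 0 L))).toReal with hC
    have hCv : eLpNorm v ⊤ (volume.restrict (Icc 0 L)) = ENNReal.ofReal C :=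
      (ENNReal.ofReal_toReal hfin).symm
    have hφ : ConvexOn ℝ univ fun y : ℝ => max (‖y‖ - C) 0 :=
      (convexOn_univ_norm.sub (concaveOn_const C convex_univ)).sup
        (convexOn_const 0 convex_univ)
    have hae := ae_comp_eq_zero_of_convex_dominated hu h hφ (fun y => le_max_right _ _) (by
      filter_upwards [ae_le_eLpNormEssSup (f := v) (μ := volume.restrict (Icc 0 L))] with x hx
      rw [← eLpNorm_exponent_top, hCv, ← ofReal_norm,
        ENNReal.ofReal_le_ofReal_iff ENNReal.toReal_nonneg] at hx
      exact max_eq_right (sub_nonpos.2 hx))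
    rw [hCv, eLpNorm_exponent_top]
    refine eLpNormEssSup_le_of_ae_bound (hae.mono fun x hx => ?_)
    have := le_max_left (‖u x‖ - C) 0
    linarith
  · have hp0 : p ≠ 0 := (zero_lt_one.trans_le hp).ne'
    have hp1 : 1 ≤ p.toReal := by
      simpa using ENNReal.toReal_mono hp' hp
    rw [(memLp_of_continuousOn_Icc hu p).eLpNorm_eq_integral_rpow_norm hp0 hp',
      (memLp_of_continuousOn_Icc hv p).eLpNorm_eq_integral_rpow_norm hp0 hp']
    refine ENNReal.ofReal_le_ofReal (Real.rpow_le_rpow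
      (integral_nonneg fun x => by positivity) (h _ (convexOn_abs_rpow hp1)) (by positivity))

lemma exists_isGreatest_isLeast_of_convex_dominated (hL : 0 < L) (hu : ContinuousOn u (Icc 0 L))
    (hv : ContinuousOn v (Icc 0 L))
    (h : ∀ φ : ℝ → ℝ, ConvexOn ℝ univ φ →
      ∫ x in Icc 0 L, φ (u x) ≤ ∫ x in Icc 0 L, φ (v x)) :
    ∃ Mu mu Mv mv : ℝ,
      IsGreatest (u '' Icc 0 L) Mu ∧ IsLeast (u '' Icc 0 L) mu ∧
      IsGreatest (v '' Icc 0 L) Mv ∧ IsLeast (v '' Icc 0 L) mv ∧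
      Mu ≤ Mv ∧ mv ≤ mu ∧ Mu - mu ≤ Mv - mv := by
  have hne : (Icc 0 L).Nonempty := nonempty_Icc.2 hL.le
  have hcu := isCompact_Icc.image_of_continuousOn hu
  have hcv := isCompact_Icc.image_of_continuousOn hv
  obtain ⟨Mu, hMu⟩ := hcu.exists_isGreatest (hne.image u)
  obtain ⟨mu, hmu⟩ := hcu.exists_isLeast (hne.image u)
  obtain ⟨Mv, hMv⟩ := hcv.exists_isGreatest (hne.image v)
  obtain ⟨mv, hmv⟩ := hcv.exists_isLeast (hne.image v)
  have hM : Mu ≤ Mv := by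
    obtain ⟨x, hx, rfl⟩ := hMu.1
    have hφ : ConvexOn ℝ univ fun y : ℝ => max (y - Mv) 0 :=
      ((convexOn_id convex_univ).sub (concaveOn_const Mv convex_univ)).sup
        (convexOn_const 0 convex_univ)
    have h0 := comp_eq_zero_of_convex_dominated hL hu h hφ (fun y => le_max_right _ _)
      (fun y hy => max_eq_right (sub_nonpos.2 (hMv.2 ⟨y, hy, rfl⟩))) hx
    have := le_max_left (u x - Mv) 0
    linarith
  have hm : mv ≤ mu := by
    obtain ⟨x, hx, rfl⟩ := hmu.1
    have hφ : ConvexOn ℝ univ fun y : ℝ => max (mv - y) 0 :=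
      ((convexOn_const mv convex_univ).sub (concaveOn_id convex_univ)).sup
        (convexOn_const 0 convex_univ)
    have h0 := comp_eq_zero_of_convex_dominated hL hu h hφ (fun y => le_max_right _ _)
      (fun y hy => max_eq_right (sub_nonpos.2 (hmv.2 ⟨y, hy, rfl⟩))) hx
    have := le_max_left (mv - u x) 0
    linarith
  exact ⟨Mu, mu, Mv, mv, hMu, hmu, hMv, hmv, hM, hm, by linarith⟩

end Consequences

/-! ### The comparison principle on `[0, π]`. -/

theorem theorem1p2 (f u v : ℝ → ℝ)
    (hf : IntegrableOn f (Icc 0 Real.pi))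
    (hf_mean : ∫ x in Icc 0 Real.pi, f x = 0)
    (hu : IsNeumannSolution 0 Real.pi (fun x => (f x : EReal)) u)
    (hv : IsNeumannSolution 0 Real.pi (decreasingRearrangement (Icc 0 Real.pi) f) v)
    (hu_mean : ∫ x in Icc 0 Real.pi, u x = 0)
    (hv_mean : ∫ x in Icc 0 Real.pi, v x = 0) :
    (∀ φ : ℝ → ℝ, ConvexOn ℝ univ φ →
      IntegrableOn (fun x => φ (u x)) (Icc 0 Real.pi) ∧
      IntegrableOn (fun x => φ (v x)) (Icc 0 Real.pi) ∧
      ∫ x in Icc 0 Real.pi, φ (u x) ≤ ∫ x in Icc 0 Real.pi, φ (v x)) ∧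
    (∀ p : ENNReal, 1 ≤ p →
      eLpNorm u p (volume.restrict (Icc 0 Real.pi)) ≤
        eLpNorm v p (volume.restrict (Icc 0 Real.pi))) ∧
    ∃ Mu mu Mv mv : ℝ,
      IsGreatest (u '' Icc 0 Real.pi) Mu ∧ IsLeast (u '' Icc 0 Real.pi) mu ∧
      IsGreatest (v '' Icc 0 Real.pi) Mv ∧ IsLeast (v '' Icc 0 Real.pi) mv ∧
      Mu ≤ Mv ∧ mv ≤ mu ∧ Mu - mu ≤ Mv - mv := by
  have huc := hu.continuousOn
  have hvc := hv.continuousOn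
  have hmain : ∀ φ : ℝ → ℝ, ConvexOn ℝ univ φ →
      ∫ x in Icc 0 Real.pi, φ (u x) ≤ ∫ x in Icc 0 Real.pi, φ (v x) := fun φ hφ =>
    integral_convex_comp_le huc hvc (antitoneOn_sub_realRearrangement hf hf_mean hu hv)
      (hu_mean.trans hv_mean.symm) hφ
  refine ⟨fun φ hφ => ⟨?_, ?_, hmain φ hφ⟩,
    fun p hp => eLpNorm_le_of_convex_dominated huc hvc hmain hp,
    exists_isGreatest_isLeast_of_convex_dominated Real.pi_pos huc hvc hmain⟩
  · exact (hφ.continuous_of_univ.comp_continuousOn huc).integrableOn_Icc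
  · exact (hφ.continuous_of_univ.comp_continuousOn hvc).integrableOn_Icc
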